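/- **Setting.** Let $X$ be a Banach space, $T>0$, $M>0$, $w\in\mathbb R$. Let $(\xi_i)_{i\ge1}$ be independent random variables, uniformly distributed on $[-1,1]$, on a probability space $(\Omega,\mathcal F,\mathbb P)$. Let $p_n$ be the Legendre polynomials, $\mathcal I$ the set of finitely supported sequences $\alpha=(\alpha_1,\alpha_2,\dots)$ of non-negative integers, $|\alpha|=\sum_i\alpha_i$, and $L_\alpha=\prod_i p_{\alpha_i}(\xi_i)$. For $F\in L^2(\Omega,\mathbb P;X)$ put $F_\alpha=\mathbb E(FL_\alpha)/\mathbb E L_\alpha^2$. Write $F\in X\otimes(L)^2$ if $F=\sum_{\alpha}F_\alpha L_\alpha$ (unconditionally in $L^2(\Omega,\mathbb P;X)$) and $\sum_\alpha\|F_\alpha\|_X^2\,\mathbb E L_\alpha^2<\infty$. For a process $u(t,\omega)$ and $E=C([a,b],X)$ or $C^1([a,b],X)$, write $u\in E\otimes(L)^2$ if $u(t)=\sum_\alpha u_\alpha(t)L_\alpha$ in the same sense for all $t\in[a,b]$, $u_\alpha\in E$ for all $\alpha$, and $\|u\|^2_{E\otimes (L)^2}:=\sum_\alpha\|u_\alpha\|_E^2\,\mathbb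 E L_\alpha^2<\infty$; here $\|f\|^2_{C([a,b],X)}=\sup_{[a,b]}\|f\|_X^2$ and $\|f\|^2_{C^1([a,b],X)}=\sup_{[a,b]}\|f\|_X^2+\sup_{[a,b]}\|f'\|_X^2$. Write $u\in C^1((0,T],X)\otimes(L)^2$ if $u\in C^1([\delta,T],X)\otimes(L)^2$ for all $0<\delta<T$. **Assumptions.** (A1) $\mathcal L$ is a densely defined linear operator in $X$, the infinitesimal generator of a $C_0$ semigroup $(S_t)_{t\ge0}$ with $\|S_t\|\le Me^{wt}$ for $t\ge0$; it acts coordinatewise on processes, $\mathcal L u=\sum_\alpha\mathcal L(u_\alpha)L_\alpha$. (A2) $u^0\in X\otimes(L)^2$, $u^0_\alpha\in\mathcal D(\mathcal L)$ for all $\alpha$, and $\sum_\alpha\|\mathcal L u^0_\alpha\|_X^2\,\mathbb E L_\alpha^2<\infty$. (A3) $G=\sum_\alpha g_\alpha L_\alpha\in C^1([0,T],X)\otimes(L)^2$. A classical solution of $$u_t=\mathcal L u+G,\qquad u(0)=u^0 \tag{1}$$ is a process $u\in C([0,T],X)\otimes(L)^2\cap C^1((0,T],X)\otimes(L)^2$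 that satisfies the equation almost surely at every $t\in(0,T]$, where $u_t=\sum_\alpha u_\alpha'(t)L_\alpha$ and $\mathcal L u=\sum_\alpha\mathcal L(u_\alpha(t))L_\alpha$ (series in $L^2(\Omega,\mathbb P;X)$), and satisfies the initial condition almost surely. **Theorem.** There is a constant $c>0$ depending only on $M$, $w$ and $T$ such that, whenever (A1)–(A3) hold, the following is true. If $X$ is a Hilbert space, then (1) has a classical solution. Every classical solution $u$ of (1) (for any Banach space $X$) belongs to $C^1([0,T],X)\otimes(L)^2$. Moreover, for all $m,K\in\mathbb N_0$, with $\mathcal I_{m,K}=\{\alpha\in\mathcal I:\alpha_i=0\text{ for } i>m,\ |\alpha|\le K\}$ and $\tilde u=\sum_{\alpha\in\mathcal I_{m,K}}u_\alpha L_\alpha$, the processes $\tilde u$ and $u-\tilde u$ belong to $C^1([0,T],X)\otimes(L)^2$ and $$\|u-\tilde u\|^2_{C^1([0,T],X)\otimes(L)^2}\le c\sum_{\alpha\in\mathcal I\setminus\mathcal I_{m,K}}\Big(\|u^0_\alpha\|_X^2+\|\mathcal L u^0_\alpha\|_X^2+\|g_\alpha\|^2_{C^1([0,T],X)}\Big)\,\mathbb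 E L_\alpha^2<\infty .$$ -/

import Mathlib

open MeasureTheory ProbabilityTheory Filter Topology

noncomputable section

namespace WienerLegendre

universe u v

/-! ### Operator semigroups -/

/-- A `C₀` semigroup `(S_t)_{t ≥ 0}` of bounded operators; only times `t ≥ 0` are relevant. -/
structure IsC0Semigroup {X : Type u} [NormedAddCommGroup X] [NormedSpace ℝ X]
    (S : ℝ → X →L[ℝ] X) : Prop where
  map_zero : S 0 = ContinuousLinearMap.id ℝ X
  map_add : ∀ s t : ℝ, 0 ≤ s → 0 ≤ t → S (s + t) = (S s).comp (S t)
  tendsto_zero : ∀ x : X, Tendsto (fun t => S t x) (𝓝[>] 0) (𝓝 x)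

/-- `𝓛` is the infinitesimal generator of `S`: its graph consists of all pairs `(x, y)` such that
`(S_t x - x) / t → y` as `t ↓ 0`. -/
def IsGenerator {X : Type u} [NormedAddCommGroup X] [NormedSpace ℝ X]
    (S : ℝ → X →L[ℝ] X) (𝓛 : X →ₗ.[ℝ] X) : Prop :=
  ∀ x y : X, (x, y) ∈ 𝓛.graph ↔ Tendsto (fun t : ℝ => t⁻¹ • (S t x - x)) (𝓝[>] 0) (𝓝 y)

/-! ### Fourier–Legendre polynomials -/

/-- The Legendre polynomials, `(n+1) p_{n+1} = (2n+1) x p_n - n p_{n-1}`. -/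
def legendre : ℕ → Polynomial ℝ
  | 0 => 1
  | 1 => Polynomial.X
  | n + 2 => Polynomial.C ((n + 2 : ℝ)⁻¹) *
      (Polynomial.C (2 * n + 3 : ℝ) * Polynomial.X * legendre (n + 1)
        - Polynomial.C (n + 1 : ℝ) * legendre n)

/-- The set `𝓘` of finitely supported multi-indices (the components are numbered from `0`). -/
abbrev MultiIndex : Type := ℕ →₀ ℕ

/-- `𝓘_{m,K}`: at most the first `m` components are non-zero, and the length is at most `K`. -/
def truncIndex (m K : ℕ) : Set MultiIndex :=
  {α | (∀ i, m ≤ i → α i = 0) ∧ (α.sum fun _ n => n) ≤ K}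

theorem truncIndex_finite (m K : ℕ) : (truncIndex m K).Finite := by
  refine Set.Finite.subset
    (((Finset.range (K + 1)).biUnion
      fun k => (Finset.range m).finsuppAntidiag k).finite_toSet) ?_
  rintro α ⟨h1, h2⟩
  simp only [Finset.coe_biUnion, Set.mem_iUnion, Finset.mem_coe, Finset.mem_range,
    Finset.mem_finsuppAntidiag]
  have hs : α.support ⊆ Finset.range m := by
    intro i hi
    by_contra h
    exact (Finsupp.mem_support_iff.mp hi) (h1 i (by simpa using h))
  exact ⟨α.sum fun _ n => n, by omega,
    (Finsupp.sum_of_support_subset α hs (fun _ n => n) (fun _ _ => rfl)).symm, hs⟩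

section Chaos

variable {Ω : Type v} [MeasurableSpace Ω] (P : Measure Ω) (ξ : ℕ → Ω → ℝ)

/-- `ξ` is a sequence of independent random variables, uniformly distributed on `[-1, 1]`. -/
structure IsUniformSequence : Prop where
  measurable : ∀ i, Measurable (ξ i)
  indep : iIndepFun ξ P
  uniform : ∀ i, pdf.IsUniform (ξ i) (Set.Icc (-1 : ℝ) 1) P volume

/-- The Fourier–Legendre polynomial `L_α(ξ) = ∏ i, p_{α i}(ξ i)` (a finite product, as
`p_0 = 1`). -/
def fourierLegendre (α : MultiIndex) (ω : Ω) : ℝ :=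
  α.prod fun i n => (legendre n).eval (ξ i ω)

/-- `𝔼 L_α²`. -/
def expSq (α : MultiIndex) : ℝ := ∫ ω, fourierLegendre ξ α ω ^ 2 ∂P

variable {X : Type u} [NormedAddCommGroup X] [NormedSpace ℝ X]

/-- `F = ∑ f_α L_α`, with unconditional convergence in `L²(Ω, P; X)`. -/
def HasChaosExpansion (F : Ω → X) (f : MultiIndex → X) : Prop :=
  MemLp F 2 P ∧
    Tendsto (fun s : Finset MultiIndex =>
      eLpNorm (fun ω => F ω - ∑ α ∈ s, fourierLegendre ξ α ω • f α) 2 P) atTop (𝓝 0)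

/-- The chaos coefficient `F_α = 𝔼(F L_α) / 𝔼 L_α²`. -/
def coeff (F : Ω → X) (α : MultiIndex) : X :=
  (expSq P ξ α)⁻¹ • ∫ ω, fourierLegendre ξ α ω • F ω ∂P

/-- `F ∈ X ⊗ (L)²`. -/
def MemTensor (F : Ω → X) : Prop :=
  HasChaosExpansion P ξ F (coeff P ξ F) ∧
    Summable fun α => ‖coeff P ξ F α‖ ^ 2 * expSq P ξ α

/-- The squared norm `sup ‖f‖²` of `C([a,b], X)`. -/
def supNormSq (a b : ℝ) (f : ℝ → X) : ℝ := ⨆ t : Set.Icc a b, ‖f t‖ ^ 2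

/-- The squared norm `sup ‖f‖² + sup ‖f'‖²` of `C¹([a,b], X)`. -/
def c1NormSq (a b : ℝ) (f : ℝ → X) : ℝ :=
  supNormSq a b f + supNormSq a b (derivWithin f (Set.Icc a b))

/-- `U ∈ C([a,b], X) ⊗ (L)²`. -/
structure MemTensorC (a b : ℝ) (U : ℝ → Ω → X) : Prop where
  expansion : ∀ t ∈ Set.Icc a b, HasChaosExpansion P ξ (U t) (coeff P ξ (U t))
  continuousOn : ∀ α, ContinuousOn (fun t => coeff P ξ (U t) α) (Set.Icc a b)
  summable : Summable fun α => supNormSq a b (fun t => coeff P ξ (U t) α) * expSq P ξ α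

/-- `U ∈ C¹([a,b], X) ⊗ (L)²`. -/
structure MemTensorC1 (a b : ℝ) (U : ℝ → Ω → X) : Prop where
  expansion : ∀ t ∈ Set.Icc a b, HasChaosExpansion P ξ (U t) (coeff P ξ (U t))
  contDiffOn : ∀ α, ContDiffOn ℝ 1 (fun t => coeff P ξ (U t) α) (Set.Icc a b)
  summable : Summable fun α => c1NormSq a b (fun t => coeff P ξ (U t) α) * expSq P ξ α

/-- The squared norm of `C¹([a,b], X) ⊗ (L)²`. -/
def tensorC1NormSq (a b : ℝ) (U : ℝ → Ω → X) : ℝ :=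
  ∑' α, c1NormSq a b (fun t => coeff P ξ (U t) α) * expSq P ξ α

/-- `H = 𝓛 F` for the coordinatewise operator `𝓛 F = ∑ 𝓛(F_α) L_α`. -/
def IsCoordImage (𝓛 : X →ₗ.[ℝ] X) (F H : Ω → X) : Prop :=
  ∃ h : ∀ α, coeff P ξ F α ∈ 𝓛.domain,
    HasChaosExpansion P ξ H fun α => 𝓛 ⟨coeff P ξ F α, h α⟩

/-- `V = (d/dt) U` at time `t ∈ [0,T]`, for the coordinatewise derivative
`(d/dt) U = ∑ (d/dt U_α) L_α`. -/
def IsCoordDeriv (T : ℝ) (U : ℝ → Ω → X) (t : ℝ) (V : Ω → X) : Prop :=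
  (∀ α, DifferentiableWithinAt ℝ (fun s => coeff P ξ (U s) α) (Set.Icc 0 T) t) ∧
    HasChaosExpansion P ξ V fun α =>
      derivWithin (fun s => coeff P ξ (U s) α) (Set.Icc 0 T) t

/-- `U` is a classical solution of `U_t = 𝓛 U + G`, `U(0) = u⁰` on `[0,T]`: it belongs to
`C([0,T], X) ⊗ (L)²` and to `C¹((0,T], X) ⊗ (L)²` (that is, to `C¹([δ,T], X) ⊗ (L)²` for all
`0 < δ < T`), and it satisfies the equation at all times `t ∈ (0,T]` and the initial condition. -/
structure IsClassicalSolution (T : ℝ) (𝓛 : X →ₗ.[ℝ] X) (G : ℝ → Ω → X) (u₀ : Ω → X)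
    (U : ℝ → Ω → X) : Prop where
  memC : MemTensorC P ξ 0 T U
  memC1 : ∀ δ, 0 < δ → δ < T → MemTensorC1 P ξ δ T U
  equation : ∀ t, 0 < t → t ≤ T → ∃ V W : Ω → X,
    IsCoordDeriv P ξ T U t V ∧ IsCoordImage P ξ 𝓛 (U t) W ∧ V =ᵐ[P] fun ω => W ω + G t ω
  initial : U 0 =ᵐ[P] u₀

/-- The truncated process `∑_{α ∈ 𝓘_{m,K}} U_α L_α`. -/
def truncated (m K : ℕ) (U : ℝ → Ω → X) (t : ℝ) (ω : Ω) : X :=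
  ∑ α ∈ (truncIndex_finite m K).toFinset, fourierLegendre ξ α ω • coeff P ξ (U t) α

end Chaos

end WienerLegendre

end

open WienerLegendre

/-!
Since `u ↦ u_α` commutes with the coordinatewise operators, each chaos coefficient of a classical
solution solves the deterministic Cauchy problem `u_α' = 𝓛 u_α + g_α`, `u_α(0) = u⁰_α`; conversely,
solutions of these problems give a classical solution if the series converge. Comparing coefficients is legitimate because the
Fourier–Legendre polynomials are orthogonal with `𝔼 L_α² > 0` (`HasChaosExpansion.coeff_eq`). By
independence this reduces to the orthogonality of the Legendre polynomials in `L²(-1, 1)`, which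
follows from their differential equation (`legendre_ode`).

The deterministic problem has at most one solution (`IsC0Semigroup.eqOn_of_solutions`): for a
solution `w` of the homogeneous problem, `s ↦ S_{t-s} w(s)` is constant. It has a solution of class
`C¹` up to the initial time (`exists_c1_solution`), namely `v(t) = u⁰_α + ∫_0^t z`, where
`z(t) = S_t (𝓛 u⁰_α + g_α(0)) + ∫_0^t S_{t-s} g_α'(s) ds` is the mild solution of the
differentiated equation. Applying `(S_h - 1) / h` to `v` and letting `h ↓ 0` shows `𝓛 v = z - g_α`,
and the bound on `‖S_t‖` gives `‖v‖² ≤ c (‖u⁰_α‖² + ‖𝓛 u⁰_α‖² + ‖g_α‖²)` in the respective `C¹`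
norms, with `c` depending only on `M`, `w` and `T`.

Hence every classical solution has the coefficients `v`, and summing the bound with weights
`𝔼 L_α²` gives both its regularity and the error estimate. In a Hilbert space, orthogonality makes
square summability of coefficients sufficient for convergence of the expansion
(`exists_hasChaosExpansion`), so the series with coefficients `v` defines a classical solution.
-/

namespace WienerLegendre

/-! ### Legendre polynomials -/

section Legendre

open Polynomial

/-- The two classical first-order identities, proved together by induction from the three-term
recurrence. They combine to `(1 - x²) p_{n+1}' = (n + 1) (p_n - x p_{n+1})`, and hence to Legendre's
equation. -/
theorem legendre_derivative_identities (n : ℕ) :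
    derivative (legendre (n + 1)) = X * derivative (legendre n) + C (n + 1 : ℝ) * legendre n ∧
    X * derivative (legendre (n + 1)) =
      derivative (legendre n) + C (n + 1 : ℝ) * legendre (n + 1) := by
  induction n with
  | zero => simp [legendre]
  | succ n ih =>
    obtain ⟨hA, hB⟩ := ih
    have h0 : C ((n : ℝ) + 2) * C ((n + 2 : ℝ)⁻¹) = 1 := by
      rw [← C_mul, mul_inv_cancel₀ (by positivity), C_1]
    have hrec : C ((n : ℝ) + 2) * legendre (n + 2) =
        C (2 * n + 3 : ℝ) * X * legendre (n + 1) - C (n + 1 : ℝ) * legendre n := by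
      rw [legendre, ← mul_assoc, h0, one_mul]
    have hrec' : C ((n : ℝ) + 2) * derivative (legendre (n + 2)) =
        C (2 * n + 3 : ℝ) * (legendre (n + 1) + X * derivative (legendre (n + 1)))
          - C (n + 1 : ℝ) * derivative (legendre n) := by
      have := congrArg derivative hrec
      simp only [derivative_mul, derivative_C, derivative_X, derivative_sub] at this
      linear_combination this
    have hA' : derivative (legendre (n + 2)) =
        X * derivative (legendre (n + 1)) + C (n + 2 : ℝ) * legendre (n + 1) := by
      have hne : C ((n : ℝ) + 2) ≠ 0 := by
        rw [Ne, C_eq_zero]; positivity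
      apply mul_left_cancel₀ hne
      simp only [map_add, map_mul, map_natCast, map_one, map_ofNat] at *
      linear_combination hrec' + ((n : ℝ[X]) + 1) * hB
    constructor
    · push_cast
      rw [hA']
      simp only [map_add, map_natCast, map_one, map_ofNat]
      ring
    · push_cast
      rw [hA']
      simp only [map_add, map_mul, map_natCast, map_one, map_ofNat] at *
      linear_combination (X : ℝ[X]) * hB - hA - hrec

/-- Legendre's differential equation, `((1 - x²) p_n')' = -n (n + 1) p_n`. -/
theorem legendre_ode (n : ℕ) :
    derivative ((1 - X ^ 2) * derivative (legendre n)) =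
      - C (n * (n + 1) : ℝ) * legendre n := by
  cases n with
  | zero => simp [legendre]
  | succ n =>
    obtain ⟨hA, hB⟩ := legendre_derivative_identities n
    have h : (1 - X ^ 2) * derivative (legendre (n + 1)) =
        C (n + 1 : ℝ) * (legendre n - X * legendre (n + 1)) := by
      linear_combination hA - X * hB
    rw [h]
    simp only [derivative_mul, derivative_C, derivative_X, derivative_sub]
    push_cast
    simp only [map_add, map_mul, map_natCast, map_one] at *
    linear_combination -((n : ℝ[X]) + 1) * hB

theorem legendre_eval_one (n : ℕ) : (legendre n).eval 1 = 1 := by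
  suffices h : (legendre n).eval 1 = 1 ∧ (legendre (n + 1)).eval 1 = 1 from h.1
  induction n with
  | zero => simp [legendre]
  | succ n ih =>
    refine ⟨ih.2, ?_⟩
    have : (n : ℝ) + 2 ≠ 0 := by positivity
    simp only [legendre, eval_mul, eval_C, eval_sub, eval_X, ih.1, ih.2]
    field_simp
    ring

theorem integral_legendre_mul_legendre {m n : ℕ} (h : m ≠ n) :
    ∫ x in (-1 : ℝ)..1, (legendre m).eval x * (legendre n).eval x = 0 := by
  -- Lagrange's identity: the Wronskian-type antiderivative vanishes at both end points.
  set W : ℝ[X] := (1 - X ^ 2) * (legendre m * derivative (legendre n)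
    - legendre n * derivative (legendre m)) with hW
  have hW' : derivative W =
      C ((m * (m + 1) : ℝ) - n * (n + 1)) * (legendre m * legendre n) := by
    have hm := legendre_ode m
    have hn := legendre_ode n
    rw [derivative_mul] at hm hn
    rw [hW]
    simp only [derivative_mul, derivative_sub (R := ℝ), map_sub] at *
    linear_combination legendre m * hn - legendre n * hm
  have hint : ∫ x in (-1 : ℝ)..1, (derivative W).eval x = W.eval 1 - W.eval (-1) :=
    intervalIntegral.integral_eq_sub_of_hasDerivAt (fun x _ => W.hasDerivAt x)
      ((derivative W).continuous.intervalIntegrable _ _)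
  rw [hW'] at hint
  simp only [eval_mul, eval_C, intervalIntegral.integral_const_mul] at hint
  have h1 : W.eval 1 - W.eval (-1) = 0 := by simp [hW]
  rw [h1] at hint
  refine (mul_eq_zero.mp hint).resolve_left fun h0 => h ?_
  have h2 : ((m : ℝ) - n) * (m + n + 1) = 0 := by linear_combination h0
  have h3 : (m : ℝ) + n + 1 ≠ 0 := by positivity
  exact_mod_cast sub_eq_zero.mp ((mul_eq_zero.mp h2).resolve_right h3)

theorem integral_legendre_sq_pos (n : ℕ) :
    0 < ∫ x in (-1 : ℝ)..1, (legendre n).eval x * (legendre n).eval x := by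
  refine intervalIntegral.integral_pos (by norm_num)
    ((legendre n).continuous.mul (legendre n).continuous).continuousOn
    (fun x _ => mul_self_nonneg _) ⟨1, by norm_num, ?_⟩
  simp [legendre_eval_one]

end Legendre

/-! ### Orthogonality of the Fourier–Legendre polynomials -/

section Orthogonality

theorem fourierLegendre_eq_prod {Ω : Type*} {ξ : ℕ → Ω → ℝ} {α : MultiIndex} {s : Finset ℕ}
    (hs : α.support ⊆ s) (ω : Ω) :
    fourierLegendre ξ α ω = ∏ i ∈ s, (legendre (α i)).eval (ξ i ω) :=
  Finsupp.prod_of_support_subset α hs _ fun _ _ => by simp [legendre]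

variable {Ω : Type*} [MeasurableSpace Ω] {P : Measure Ω} {ξ : ℕ → Ω → ℝ}

theorem measurable_fourierLegendre (hξ : IsUniformSequence P ξ) (α : MultiIndex) :
    Measurable (fourierLegendre ξ α) :=
  Finset.measurable_fun_prod _ fun i _ =>
    (legendre (α i)).continuous.measurable.comp (hξ.measurable i)

theorem integral_comp_uniform (hξ : IsUniformSequence P ξ) (i : ℕ) {f : ℝ → ℝ}
    (hf : Continuous f) : ∫ ω, f (ξ i ω) ∂P = 2⁻¹ * ∫ x in (-1 : ℝ)..1, f x := by
  have h := hξ.uniform i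
  rw [pdf.IsUniform] at h
  rw [← integral_map (hξ.measurable i).aemeasurable hf.aestronglyMeasurable, h,
    ProbabilityTheory.cond, integral_smul_measure, Real.volume_Icc,
    intervalIntegral.integral_of_le (by norm_num), integral_Icc_eq_integral_Ioc]
  norm_num [ENNReal.toReal_inv]

theorem ae_mem_Icc (hξ : IsUniformSequence P ξ) : ∀ᵐ ω ∂P, ∀ i, ξ i ω ∈ Set.Icc (-1 : ℝ) 1 := by
  refine ae_all_iff.mpr fun i => ?_
  refine ae_of_ae_map (p := fun x => x ∈ Set.Icc (-1 : ℝ) 1) (hξ.measurable i).aemeasurable ?_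
  have h := hξ.uniform i
  rw [pdf.IsUniform] at h
  rw [h]
  exact ProbabilityTheory.ae_cond_mem measurableSet_Icc

theorem expSq_eq (α : MultiIndex) :
    expSq P ξ α = ∫ ω, fourierLegendre ξ α ω * fourierLegendre ξ α ω ∂P := by
  simp only [expSq, sq]

theorem memLp_fourierLegendre [IsProbabilityMeasure P] (hξ : IsUniformSequence P ξ)
    (α : MultiIndex) (p : ENNReal) : MemLp (fourierLegendre ξ α) p P := by
  have hb : ∀ n : ℕ, ∃ C : ℝ, ∀ x ∈ Set.Icc (-1 : ℝ) 1, ‖(legendre n).eval x‖ ≤ C := fun n =>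
    isCompact_Icc.exists_bound_of_continuousOn (legendre n).continuous.continuousOn
  choose C hC using hb
  refine MemLp.of_bound (measurable_fourierLegendre hξ α).aestronglyMeasurable
    (∏ i ∈ α.support, C (α i)) ?_
  filter_upwards [ae_mem_Icc hξ] with ω hω
  rw [fourierLegendre, Finsupp.prod, norm_prod]
  exact Finset.prod_le_prod (fun _ _ => norm_nonneg _) fun i _ => hC _ _ (hω i)

theorem integral_fourierLegendre_mul (hξ : IsUniformSequence P ξ) (α β : MultiIndex) :
    ∫ ω, fourierLegendre ξ α ω * fourierLegendre ξ β ω ∂P =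
      ∏ i ∈ α.support ∪ β.support,
        (2⁻¹ * ∫ x in (-1 : ℝ)..1, (legendre (α i)).eval x * (legendre (β i)).eval x) := by
  set s := α.support ∪ β.support
  have h := iIndepFun.integral_fun_prod_comp (X := fun (i : s) ω => ξ i ω)
    (hξ.indep.precomp (g := ((↑) : s → ℕ)) Subtype.val_injective)
    (f := fun (i : s) x => (legendre (α i)).eval x * (legendre (β i)).eval x)
    (fun i => (hξ.measurable i).aemeasurable)
    (fun i => ((legendre (α i)).continuous.mul (legendre (β i)).continuous).aestronglyMeasurable)
  rw [Finset.prod_coe_sort s fun i =>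
    ∫ ω, (legendre (α i)).eval (ξ i ω) * (legendre (β i)).eval (ξ i ω) ∂P] at h
  calc _ = _ := integral_congr_ae (.of_forall fun ω => by
        rw [fourierLegendre_eq_prod (s := s) Finset.subset_union_left,
          fourierLegendre_eq_prod (s := s) Finset.subset_union_right, ← Finset.prod_mul_distrib,
          Finset.prod_coe_sort s fun i =>
            (legendre (α i)).eval (ξ i ω) * (legendre (β i)).eval (ξ i ω)])
    _ = _ := h
    _ = _ := Finset.prod_congr rfl fun i _ => integral_comp_uniform hξ i
      ((legendre (α i)).continuous.mul (legendre (β i)).continuous)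

theorem integral_fourierLegendre_mul_of_ne [IsProbabilityMeasure P]
    (hξ : IsUniformSequence P ξ) {α β : MultiIndex} (h : α ≠ β) :
    ∫ ω, fourierLegendre ξ α ω * fourierLegendre ξ β ω ∂P = 0 := by
  obtain ⟨i, hi⟩ : ∃ i, α i ≠ β i := by
    by_contra! hc
    exact h (Finsupp.ext hc)
  rw [integral_fourierLegendre_mul hξ]
  refine Finset.prod_eq_zero (i := i) ?_ (by rw [integral_legendre_mul_legendre hi, mul_zero])
  simp only [Finset.mem_union, Finsupp.mem_support_iff]
  omega

theorem expSq_pos [IsProbabilityMeasure P] (hξ : IsUniformSequence P ξ) (α : MultiIndex) :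
    0 < expSq P ξ α := by
  rw [expSq_eq, integral_fourierLegendre_mul hξ]
  exact Finset.prod_pos fun i _ => mul_pos (by norm_num) (integral_legendre_sq_pos _)

end Orthogonality

/-! ### Chaos expansions -/

section Expansion

variable {Ω : Type*} [MeasurableSpace Ω] {P : Measure Ω}
  {ξ : ℕ → Ω → ℝ} {X : Type*} [NormedAddCommGroup X] [NormedSpace ℝ X]

theorem HasChaosExpansion.congr_ae {F F' : Ω → X} {f : MultiIndex → X}
    (h : HasChaosExpansion P ξ F f) (hF : F =ᵐ[P] F') : HasChaosExpansion P ξ F' f := by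
  refine ⟨(memLp_congr_ae hF).mp h.1, h.2.congr fun s => eLpNorm_congr_ae ?_⟩
  filter_upwards [hF] with ω hω
  rw [hω]

variable [IsProbabilityMeasure P]

theorem memLp_fourierLegendre_smul (hξ : IsUniformSequence P ξ) (α : MultiIndex) (x : X)
    (p : ENNReal) : MemLp (fun ω => fourierLegendre ξ α ω • x) p P :=
  (memLp_top_const x).smul (memLp_fourierLegendre hξ α p)

theorem memLp_sum_fourierLegendre_smul (hξ : IsUniformSequence P ξ) (s : Finset MultiIndex)
    (f : MultiIndex → X) (p : ENNReal) :
    MemLp (fun ω => ∑ α ∈ s, fourierLegendre ξ α ω • f α) p P :=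
  memLp_finsetSum s fun α _ => memLp_fourierLegendre_smul hξ α (f α) p

/-- The coefficients of an expansion are determined by its sum: `F ↦ 𝔼(F L_α)` is continuous
on `L²`, and the `L_α` are orthogonal. -/
theorem HasChaosExpansion.coeff_eq [CompleteSpace X] (hξ : IsUniformSequence P ξ) {F : Ω → X}
    {f : MultiIndex → X} (h : HasChaosExpansion P ξ F f) (α : MultiIndex) :
    coeff P ξ F α = f α := by
  obtain ⟨hF, hlim⟩ := h
  have hLF : Integrable (fun ω => fourierLegendre ξ α ω • F ω) P :=
    memLp_one_iff_integrable.mp (hF.smul (memLp_fourierLegendre hξ α 2))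
  have hterm : ∀ β, Integrable
      (fun ω => fourierLegendre ξ α ω • fourierLegendre ξ β ω • f β) P := fun β =>
    memLp_one_iff_integrable.mp
      ((memLp_fourierLegendre_smul hξ β (f β) 2).smul (memLp_fourierLegendre hξ α 2))
  set a : X := ∫ ω, fourierLegendre ξ α ω • F ω ∂P - expSq P ξ α • f α with ha
  have hint : ∀ s : Finset MultiIndex, α ∈ s →
      ∫ ω, fourierLegendre ξ α ω • (F ω - ∑ β ∈ s, fourierLegendre ξ β ω • f β) ∂P = a := by
    intro s hs
    simp only [smul_sub, Finset.smul_sum]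
    rw [integral_sub hLF (integrable_finsetSum _ fun β _ => hterm β),
      integral_finsetSum _ fun β _ => hterm β, Finset.sum_eq_single_of_mem α hs]
    · simp only [smul_smul]
      rw [integral_smul_const, ← expSq_eq]
    · intro β _ hβ
      simp only [smul_smul]
      rw [integral_smul_const, integral_fourierLegendre_mul_of_ne hξ hβ.symm, zero_smul]
  have hle : ∀ᶠ s : Finset MultiIndex in atTop, ‖a‖ₑ ≤ eLpNorm (fourierLegendre ξ α) 2 P *
      eLpNorm (fun ω => F ω - ∑ β ∈ s, fourierLegendre ξ β ω • f β) 2 P := by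
    filter_upwards [eventually_ge_atTop {α}] with s hs
    rw [← hint s (hs (Finset.mem_singleton_self α))]
    refine (enorm_integral_le_lintegral_enorm _).trans ?_
    rw [← eLpNorm_one_eq_lintegral_enorm]
    exact eLpNorm_smul_le_mul_eLpNorm
      (hF.sub (memLp_sum_fourierLegendre_smul hξ s f 2)).aestronglyMeasurable
      (measurable_fourierLegendre hξ α).aestronglyMeasurable
  have hz : Tendsto (fun s : Finset MultiIndex => eLpNorm (fourierLegendre ξ α) 2 P *
      eLpNorm (fun ω => F ω - ∑ β ∈ s, fourierLegendre ξ β ω • f β) 2 P) atTop (𝓝 0) := by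
    simpa using ENNReal.Tendsto.const_mul hlim
      (Or.inr (memLp_fourierLegendre hξ α 2).eLpNorm_ne_top)
  have ha0 : a = 0 := enorm_eq_zero.mp (le_antisymm (ge_of_tendsto hz hle) zero_le)
  rw [coeff, sub_eq_zero.mp ha0, smul_smul, inv_mul_cancel₀ (expSq_pos hξ α).ne', one_smul]

theorem HasChaosExpansion.coeff_eq' [CompleteSpace X] (hξ : IsUniformSequence P ξ) {F : Ω → X}
    {f : MultiIndex → X} (h : HasChaosExpansion P ξ F f) : coeff P ξ F = f :=
  funext (h.coeff_eq hξ)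

theorem HasChaosExpansion.sub (hξ : IsUniformSequence P ξ) {F G : Ω → X} {f g : MultiIndex → X}
    (hF : HasChaosExpansion P ξ F f) (hG : HasChaosExpansion P ξ G g) :
    HasChaosExpansion P ξ (fun ω => F ω - G ω) fun α => f α - g α := by
  refine ⟨hF.1.sub hG.1, ?_⟩
  refine tendsto_of_tendsto_of_tendsto_of_le_of_le tendsto_const_nhds
    (by simpa using hF.2.add hG.2) (fun _ => zero_le) fun s => ?_
  have h := eLpNorm_sub_le (μ := P) (p := 2)
    (hF.1.sub (memLp_sum_fourierLegendre_smul hξ s f 2)).aestronglyMeasurable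
    (hG.1.sub (memLp_sum_fourierLegendre_smul hξ s g 2)).aestronglyMeasurable (by norm_num)
  refine le_trans (le_of_eq ?_) h
  congr 1
  ext ω
  simp only [smul_sub, Finset.sum_sub_distrib, Pi.sub_apply]
  abel

theorem HasChaosExpansion.ae_eq (hξ : IsUniformSequence P ξ) {F G : Ω → X} {f : MultiIndex → X}
    (hF : HasChaosExpansion P ξ F f) (hG : HasChaosExpansion P ξ G f) : F =ᵐ[P] G := by
  have h := hF.sub hξ hG
  have h0 : eLpNorm (fun ω => F ω - G ω) 2 P = 0 := by
    simpa using tendsto_nhds_unique (tendsto_const_nhds (x := eLpNorm (fun ω => F ω - G ω) 2 P))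
      (h.2.congr fun s => by simp)
  filter_upwards [(eLpNorm_eq_zero_iff h.1.aestronglyMeasurable (by norm_num)).mp h0] with ω hω
  exact sub_eq_zero.mp hω

open Classical in
theorem hasChaosExpansion_finset_sum (hξ : IsUniformSequence P ξ) (s : Finset MultiIndex)
    (f : MultiIndex → X) :
    HasChaosExpansion P ξ (fun ω => ∑ α ∈ s, fourierLegendre ξ α ω • f α)
      fun α => if α ∈ s then f α else 0 := by
  refine ⟨memLp_sum_fourierLegendre_smul hξ s f 2, ?_⟩
  refine tendsto_const_nhds.congr' ?_
  filter_upwards [eventually_ge_atTop s] with t ht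
  simp [Finset.inter_eq_right.mpr ht]

/-- In a Hilbert space the `f_α L_α` are orthogonal in `L²`, so that square summability of the
coefficients suffices for convergence. Only the parallelogram law is assumed, hence the inner
product is chosen inside the proof. -/
theorem exists_hasChaosExpansion [CompleteSpace X] [InnerProductSpaceable X]
    (hξ : IsUniformSequence P ξ) {f : MultiIndex → X}
    (hf : Summable fun α => ‖f α‖ ^ 2 * expSq P ξ α) :
    ∃ F, HasChaosExpansion P ξ F f := by
  let := InnerProductSpace.ofNorm ℝ
    (InnerProductSpaceable.parallelogram_identity (E := X))
  set e : MultiIndex → Lp X 2 P := fun α => (memLp_fourierLegendre_smul hξ α (f α) 2).toLp _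
    with he
  have hinner : ∀ α β, inner ℝ (e α) (e β) =
      (∫ ω, fourierLegendre ξ α ω * fourierLegendre ξ β ω ∂P) * inner ℝ (f α) (f β) := by
    intro α β
    rw [L2.inner_def, ← integral_mul_const]
    refine integral_congr_ae ?_
    filter_upwards [(memLp_fourierLegendre_smul hξ α (f α) 2).coeFn_toLp,
      (memLp_fourierLegendre_smul hξ β (f β) 2).coeFn_toLp] with ω h1 h2
    simp only [he]
    rw [h1, h2, real_inner_smul_left, real_inner_smul_right, mul_assoc]
  have hnorm : ∀ s : Finset MultiIndex,
      ‖∑ α ∈ s, e α‖ ^ 2 = ∑ α ∈ s, ‖f α‖ ^ 2 * expSq P ξ α := by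
    intro s
    rw [← real_inner_self_eq_norm_sq, sum_inner]
    refine Finset.sum_congr rfl fun α hα => ?_
    rw [inner_sum, Finset.sum_eq_single_of_mem α hα, hinner, real_inner_self_eq_norm_sq,
      ← expSq_eq, mul_comm]
    intro β _ hβ
    rw [hinner, integral_fourierLegendre_mul_of_ne hξ hβ.symm, zero_mul]
  have hsum : Summable e := by
    rw [summable_iff_vanishing_norm] at hf ⊢
    intro ε hε
    obtain ⟨s, hs⟩ := hf (ε ^ 2) (by positivity)
    refine ⟨s, fun t ht => lt_of_pow_lt_pow_left₀ 2 hε.le ?_⟩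
    rw [hnorm]
    exact (le_abs_self _).trans_lt (hs t ht)
  have hcoe : ∀ s : Finset MultiIndex,
      ((∑ α ∈ s, e α : Lp X 2 P) : Ω → X) =ᵐ[P]
        fun ω => ∑ α ∈ s, fourierLegendre ξ α ω • f α := by
    intro s
    induction s using Finset.cons_induction with
    | empty =>
      simp only [Finset.sum_empty]
      exact Lp.coeFn_zero _ _ _
    | cons α s hα ih =>
      simp only [Finset.sum_cons]
      filter_upwards [Lp.coeFn_add (e α) (∑ α ∈ s, e α), ih,
        (memLp_fourierLegendre_smul hξ α (f α) 2).coeFn_toLp] with ω h1 h2 h3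
      rw [h1, Pi.add_apply, h2, he, h3]
  refine ⟨(∑' α, e α : Lp X 2 P), Lp.memLp _, ?_⟩
  refine ((Lp.tendsto_Lp_iff_tendsto_eLpNorm' _ _).mp hsum.hasSum).congr fun s => ?_
  rw [eLpNorm_sub_comm]
  refine eLpNorm_congr_ae ?_
  filter_upwards [hcoe s] with ω hω
  simp only [Pi.sub_apply]
  rw [hω]

end Expansion

/-! ### Strong continuity of semigroups -/

section Semigroup

variable {X : Type*} [NormedAddCommGroup X] [NormedSpace ℝ X] {S : ℝ → X →L[ℝ] X}

theorem IsC0Semigroup.tendsto_abs_zero (hS : IsC0Semigroup S) (x : X) :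
    Tendsto (fun h : ℝ => S |h| x) (𝓝 0) (𝓝 x) := by
  have h1 : Tendsto (fun t => S t x) (𝓝[≥] 0) (𝓝 x) := by
    rw [← Set.Ioi_insert, nhdsWithin_insert, tendsto_sup]
    refine ⟨?_, hS.tendsto_zero x⟩
    rw [tendsto_pure_left]
    intro s hs
    simpa [hS.map_zero] using mem_of_mem_nhds hs
  refine h1.comp (tendsto_nhdsWithin_iff.mpr ⟨?_, .of_forall fun h => abs_nonneg h⟩)
  simpa using (continuous_abs (G := ℝ)).tendsto 0

theorem IsC0Semigroup.apply_add (hS : IsC0Semigroup S) {s t : ℝ} (hs : 0 ≤ s) (ht : 0 ≤ t)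
    (x : X) : S (s + t) x = S s (S t x) := by
  rw [hS.map_add s t hs ht]; rfl

/-- A `C₀` semigroup is jointly continuous in time and space. The absolute value extends it to
negative times. -/
theorem IsC0Semigroup.continuous_abs (hS : IsC0Semigroup S)
    (hB : ∀ b : ℝ, ∃ C : ℝ, ∀ t, 0 ≤ t → t ≤ b → ‖S t‖ ≤ C) :
    Continuous fun p : ℝ × X => S |p.1| p.2 := by
  rw [continuous_iff_continuousAt]
  rintro ⟨r, x⟩
  obtain ⟨C, hC⟩ := hB (|r| + 1)
  have hnear : ∀ᶠ p : ℝ × X in 𝓝 (r, x), |p.1| ≤ |r| + 1 :=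
    ((_root_.continuous_abs.comp continuous_fst).tendsto (r, x)).eventually_le_const (by simp)
  -- The increment along one orbit is controlled by the orbit near time `0`.
  have hincr : ∀ a b : ℝ, 0 ≤ a → a ≤ b → a ≤ |r| + 1 →
      ‖S b x - S a x‖ ≤ C * ‖S |b - a| x - x‖ := by
    intro a b ha hab har
    have : S b x - S a x = S a (S |b - a| x - x) := by
      rw [map_sub, ← hS.apply_add ha (abs_nonneg _), abs_of_nonneg (sub_nonneg.mpr hab),
        add_sub_cancel]
    rw [this]
    exact (S a).le_of_opNorm_le (hC a ha har) _
  have hle : ∀ᶠ p : ℝ × X in 𝓝 (r, x), dist (S |p.1| p.2) (S |r| x) ≤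
      C * ‖p.2 - x‖ + C * ‖S |(|p.1| - |r|)| x - x‖ := by
    filter_upwards [hnear] with p hp
    rw [dist_eq_norm]
    have : S |p.1| p.2 - S |r| x = S |p.1| (p.2 - x) + (S |p.1| x - S |r| x) := by
      rw [map_sub]; abel
    rw [this]
    refine (norm_add_le _ _).trans
      (add_le_add ((S _).le_of_opNorm_le (hC _ (abs_nonneg _) hp) _) ?_)
    rcases le_total |r| |p.1| with h | h
    · exact hincr _ _ (abs_nonneg _) h (by linarith)
    · rw [norm_sub_rev, abs_sub_comm]
      exact hincr _ _ (abs_nonneg _) h hp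
  rw [ContinuousAt, tendsto_iff_dist_tendsto_zero]
  refine squeeze_zero' (.of_forall fun _ => dist_nonneg) hle ?_
  have h1 : Tendsto (fun p : ℝ × X => C * ‖p.2 - x‖) (𝓝 (r, x)) (𝓝 0) := by
    have : Continuous fun p : ℝ × X => C * ‖p.2 - x‖ := by fun_prop
    simpa using this.tendsto (r, x)
  have h2 : Tendsto (fun p : ℝ × X => C * ‖S |(|p.1| - |r|)| x - x‖) (𝓝 (r, x)) (𝓝 0) := by
    have hc : Tendsto (fun p : ℝ × X => |p.1| - |r|) (𝓝 (r, x)) (𝓝 0) := by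
      have : Continuous fun p : ℝ × X => |p.1| - |r| := by fun_prop
      simpa using this.tendsto (r, x)
    simpa using ((((hS.tendsto_abs_zero x).comp hc).sub_const x).norm).const_mul C
  simpa using h1.add h2

/-! ### Uniqueness for the homogeneous Cauchy problem -/

/-- If `w' = 𝓛 w` on `(0, T)` and `w 0 = 0`, then `s ↦ S_{t-s} w(s)` has right derivative zero,
so its values `w t` at `s = t` and `0` at `s = 0` coincide. -/
theorem IsC0Semigroup.eq_zero_of_hasDerivWithinAt (hS : IsC0Semigroup S)
    (hB : ∀ b : ℝ, ∃ C : ℝ, ∀ t, 0 ≤ t → t ≤ b → ‖S t‖ ≤ C) {T : ℝ} {w w' : ℝ → X}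
    (hc : ContinuousOn w (Set.Icc 0 T)) (h0 : w 0 = 0)
    (hd : ∀ s ∈ Set.Ioo 0 T, HasDerivWithinAt w (w' s) (Set.Icc 0 T) s)
    (hgen : ∀ s ∈ Set.Ioo 0 T,
      Tendsto (fun h : ℝ => h⁻¹ • (S h (w s) - w s)) (𝓝[>] 0) (𝓝 (w' s))) :
    ∀ t ∈ Set.Icc 0 T, w t = 0 := by
  intro t ht
  have hJ := hS.continuous_abs hB
  rcases ht.1.eq_or_lt with rfl | ht0
  · exact h0
  set φ : ℝ → X := fun s => S |t - s| (w s) with hφ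
  have hφc : ContinuousOn φ (Set.Icc 0 t) := by
    refine hJ.comp_continuousOn (f := fun s => (t - s, w s)) ?_
    exact (continuous_const.sub continuous_id).continuousOn.prodMk
      (hc.mono (Set.Icc_subset_Icc_right ht.2))
  have hφd : ∀ s ∈ Set.Ioo 0 t, HasDerivWithinAt φ 0 (Set.Ici s) s := by
    intro s hs
    have hsT : s ∈ Set.Ioo 0 T := ⟨hs.1, hs.2.trans_le ht.2⟩
    have hw : HasDerivWithinAt w (w' s) (Set.Ici s) s :=
      ((hd s hsT).hasDerivAt (Icc_mem_nhds hsT.1 hsT.2)).hasDerivWithinAt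
    rw [← hasDerivWithinAt_Ioi_iff_Ici,
      hasDerivWithinAt_iff_tendsto_slope' Set.self_notMem_Ioi] at hw ⊢
    have hsub : Tendsto (fun y : ℝ => y - s) (𝓝[>] s) (𝓝[>] 0) := by
      refine tendsto_nhdsWithin_iff.mpr ⟨?_, ?_⟩
      · have : Continuous fun y : ℝ => y - s := by fun_prop
        simpa using (this.tendsto s).mono_left nhdsWithin_le_nhds
      · filter_upwards [self_mem_nhdsWithin] with y hy
        exact Set.mem_Ioi.mpr (sub_pos.mpr (Set.mem_Ioi.mp hy))
    have hdiff := hw.sub ((hgen s hsT).comp hsub)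
    rw [sub_self] at hdiff
    have htime : Tendsto (fun y : ℝ => t - y) (𝓝[>] s) (𝓝 (t - s)) := by
      have : Continuous fun y : ℝ => t - y := by fun_prop
      exact (this.tendsto s).mono_left nhdsWithin_le_nhds
    have hlim := (hJ.tendsto (t - s, 0)).comp (htime.prodMk_nhds hdiff)
    rw [_root_.map_zero] at hlim
    refine hlim.congr' ?_
    filter_upwards [Ioo_mem_nhdsGT hs.2] with y hy
    have e1 : φ s = S |t - y| (S (y - s) (w s)) := by
      simp only [hφ]
      rw [← hS.apply_add (abs_nonneg _) (sub_nonneg.mpr hy.1.le),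
        abs_of_nonneg (sub_nonneg.mpr hy.2.le), abs_of_nonneg (sub_nonneg.mpr hs.2.le),
        sub_add_sub_cancel]
    simp only [Function.comp_apply, slope_def_module]
    rw [e1, ← smul_sub, map_smul, hφ]
    simp only [map_sub]
    congr 1
    abel
  -- The right derivative is available only at positive times.
  have hconst : ∀ ε ∈ Set.Ioo 0 t, φ ε = φ t := fun ε hε =>
    (constant_of_has_deriv_right_zero (hφc.mono (Set.Icc_subset_Icc_left hε.1.le))
      (fun s hs => hφd s ⟨hε.1.trans_le hs.1, hs.2⟩) t ⟨hε.2.le, le_rfl⟩).symm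
  have hlim0 : Tendsto φ (𝓝[>] 0) (𝓝 (φ 0)) :=
    (hφc 0 ⟨le_rfl, ht0.le⟩).tendsto.mono_left
      (nhdsWithin_le_of_mem (mem_of_superset (Ioo_mem_nhdsGT ht0) Set.Ioo_subset_Icc_self))
  have hlimt : Tendsto φ (𝓝[>] 0) (𝓝 (φ t)) := by
    refine tendsto_const_nhds.congr' ?_
    filter_upwards [Ioo_mem_nhdsGT ht0] with ε hε
    exact (hconst ε hε).symm
  have := tendsto_nhds_unique hlim0 hlimt
  simpa [hφ, h0, hS.map_zero] using this.symm

/-! ### Existence for the inhomogeneous Cauchy problem -/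

/-- The mild solution `S_t a + ∫_0^t S_{t-s} g(s) ds` of `z' = 𝓛 z + g`, `z(0) = a`. -/
noncomputable def mildSolution (S : ℝ → X →L[ℝ] X) (a : X) (g : ℝ → X) (t : ℝ) : X :=
  S |t| a + ∫ s in (0 : ℝ)..t, S |t - s| (g s)

theorem mildSolution_zero (hS : IsC0Semigroup S) (a : X) (g : ℝ → X) :
    mildSolution S a g 0 = a := by
  simp [mildSolution, hS.map_zero]

variable {g : ℝ → X}

theorem continuous_mildSolution (hJ : Continuous fun p : ℝ × X => S |p.1| p.2) (a : X)
    (hg : Continuous g) : Continuous (mildSolution S a g) := by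
  refine Continuous.add (hJ.comp (continuous_id.prodMk continuous_const)) ?_
  exact intervalIntegral.continuous_parametric_intervalIntegral_of_continuous
    (f := fun t s => S |t - s| (g s))
    (hJ.comp ((continuous_fst.sub continuous_snd).prodMk (hg.comp continuous_snd)))
    continuous_id

theorem norm_mildSolution_le {T C N : ℝ} (hC : ∀ t, 0 ≤ t → t ≤ T → ‖S t‖ ≤ C)
    (a : X) (hN : ∀ t ∈ Set.Icc 0 T, ‖g t‖ ≤ N) {t : ℝ} (ht : t ∈ Set.Icc 0 T) :
    ‖mildSolution S a g t‖ ≤ C * ‖a‖ + C * N * T := by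
  have hC0 : 0 ≤ C := (norm_nonneg _).trans (hC t ht.1 ht.2)
  have hN0 : 0 ≤ N := (norm_nonneg _).trans (hN t ht)
  refine (norm_add_le _ _).trans (add_le_add ?_ ?_)
  · rw [abs_of_nonneg ht.1]
    exact (S t).le_of_opNorm_le (hC t ht.1 ht.2) a
  · refine (intervalIntegral.norm_integral_le_of_norm_le_const (C := C * N) ?_).trans ?_
    · intro s hs
      rw [Set.uIoc_of_le ht.1] at hs
      have h1 : |t - s| = t - s := abs_of_nonneg (sub_nonneg.mpr hs.2)
      refine ((S _).le_of_opNorm_le (hC _ (abs_nonneg _) ?_) _).trans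
        (mul_le_mul_of_nonneg_left (hN s ⟨hs.1.le, hs.2.trans ht.2⟩) hC0)
      linarith [hs.1, ht.2]
    · rw [sub_zero, abs_of_nonneg ht.1]
      exact mul_le_mul_of_nonneg_left ht.2 (by positivity)

variable [CompleteSpace X]

/-- The semigroup shifts a mild solution, up to the forcing that acts on `[s, s + h]`; the
latter is rescaled to the unit interval, where it depends continuously on `h` and `s`. -/
theorem apply_mildSolution (hS : IsC0Semigroup S)
    (hJ : Continuous fun p : ℝ × X => S |p.1| p.2) (a : X) (hg : Continuous g) {s h : ℝ}
    (hs : 0 ≤ s) (hh : 0 ≤ h) :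
    S h (mildSolution S a g s) = mildSolution S a g (s + h) -
      h • ∫ θ in (0 : ℝ)..1, S |h - h * θ| (g (h * θ + s)) := by
  have hc : ∀ t : ℝ, Continuous fun r => S |t - r| (g r) := fun t =>
    hJ.comp ((continuous_const.sub continuous_id).prodMk hg)
  have h1 : S h (∫ r in (0 : ℝ)..s, S |s - r| (g r)) =
      ∫ r in (0 : ℝ)..s, S |s + h - r| (g r) := by
    rw [← ContinuousLinearMap.intervalIntegral_comp_comm _ ((hc s).intervalIntegrable _ _)]
    refine intervalIntegral.integral_congr fun r hr => ?_
    rw [Set.uIcc_of_le hs] at hr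
    rw [← hS.apply_add hh (abs_nonneg _), abs_of_nonneg (sub_nonneg.mpr hr.2),
      abs_of_nonneg (by linarith [hr.2]), show h + (s - r) = s + h - r by ring]
  have h2 : h • ∫ θ in (0 : ℝ)..1, S |h - h * θ| (g (h * θ + s)) =
      ∫ r in s..s + h, S |s + h - r| (g r) := by
    have := intervalIntegral.smul_integral_comp_mul_add (a := 0) (b := 1)
      (fun r => S |s + h - r| (g r)) h s
    rw [mul_zero, zero_add, mul_one, add_comm h s] at this
    rw [← this]
    congr 2
    ext θ
    rw [show s + h - (h * θ + s) = h - h * θ by ring]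
  have h3 := intervalIntegral.integral_add_adjacent_intervals
    ((hc (s + h)).intervalIntegrable 0 s) ((hc (s + h)).intervalIntegrable (μ := volume) s (s + h))
  rw [h2, mildSolution, mildSolution, map_add, h1, ← h3, abs_of_nonneg hs,
    abs_of_nonneg (add_nonneg hs hh), add_comm s h, hS.apply_add hh hs]
  abel

/-- If `(x, y)` is in the graph of the generator, then `v(t) = x + ∫_0^t z` with the mild
solution `z` of `z' = 𝓛 z + g`, `z(0) = y + a` satisfies `𝓛 v(t) = z(t) - (a + ∫_0^t g)`, that is
`v' = 𝓛 v + f` for the primitive `f` of `g` with `f(0) = a`. -/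
theorem tendsto_integral_mildSolution (hS : IsC0Semigroup S)
    (hJ : Continuous fun p : ℝ × X => S |p.1| p.2) {x y : X}
    (hxy : Tendsto (fun h : ℝ => h⁻¹ • (S h x - x)) (𝓝[>] 0) (𝓝 y)) (a : X)
    (hg : Continuous g) {t : ℝ} (ht : 0 ≤ t) :
    Tendsto (fun h : ℝ => h⁻¹ • (S h (x + ∫ s in (0 : ℝ)..t, mildSolution S (y + a) g s) -
        (x + ∫ s in (0 : ℝ)..t, mildSolution S (y + a) g s))) (𝓝[>] 0)
      (𝓝 (mildSolution S (y + a) g t - (a + ∫ s in (0 : ℝ)..t, g s))) := by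
  set z := mildSolution S (y + a) g with hz
  have hzc : Continuous z := continuous_mildSolution hJ _ hg
  set K : ℝ → ℝ → X := fun h s => ∫ θ in (0 : ℝ)..1, S |h - h * θ| (g (h * θ + s)) with hK
  have hKc : Continuous (Function.uncurry K) := by
    refine intervalIntegral.continuous_parametric_intervalIntegral_of_continuous'
      (f := fun (p : ℝ × ℝ) θ => S |p.1 - p.1 * θ| (g (p.1 * θ + p.2))) ?_ 0 1
    exact hJ.comp (Continuous.prodMk (by fun_prop) (by fun_prop))
  have hA : ∀ r : ℝ, Tendsto (fun h : ℝ => ∫ θ in (0 : ℝ)..1, z (h * θ + r)) (𝓝[>] 0)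
      (𝓝 (z r)) := by
    intro r
    have : Continuous fun h : ℝ => ∫ θ in (0 : ℝ)..1, z (h * θ + r) :=
      intervalIntegral.continuous_parametric_intervalIntegral_of_continuous'
        (f := fun h θ => z (h * θ + r)) (by fun_prop) 0 1
    simpa using (this.tendsto 0).mono_left nhdsWithin_le_nhds
  have hKlim : Tendsto (fun h : ℝ => ∫ s in (0 : ℝ)..t, K h s) (𝓝[>] 0)
      (𝓝 (∫ s in (0 : ℝ)..t, g s)) := by
    have : Continuous fun h : ℝ => ∫ s in (0 : ℝ)..t, K h s :=
      intervalIntegral.continuous_parametric_intervalIntegral_of_continuous' hKc 0 t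
    simpa [hK, hS.map_zero] using (this.tendsto 0).mono_left nhdsWithin_le_nhds
  have hlim := ((hxy.add (hA t)).sub (hA 0)).sub hKlim
  have hval : y + z t - z 0 - ∫ s in (0 : ℝ)..t, g s = z t - (a + ∫ s in (0 : ℝ)..t, g s) := by
    rw [hz, mildSolution_zero hS]; abel
  rw [hval] at hlim
  refine hlim.congr' ?_
  filter_upwards [self_mem_nhdsWithin] with h hh
  have hh : 0 < h := hh
  have hi : ∀ p q : ℝ, IntervalIntegrable z volume p q := fun p q => hzc.intervalIntegrable p q
  have hKi : IntervalIntegrable (fun s => K h s) volume 0 t :=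
    (hKc.comp (continuous_const.prodMk continuous_id)).intervalIntegrable _ _
  have e1 : S h (∫ s in (0 : ℝ)..t, z s) =
      (∫ s in h..t + h, z s) - h • ∫ s in (0 : ℝ)..t, K h s := by
    rw [← ContinuousLinearMap.intervalIntegral_comp_comm _ (hi 0 t)]
    have : ∫ s in (0 : ℝ)..t, S h (z s) = ∫ s in (0 : ℝ)..t, (z (s + h) - h • K h s) := by
      refine intervalIntegral.integral_congr fun s hs => ?_
      rw [Set.uIcc_of_le ht] at hs
      exact apply_mildSolution hS hJ _ hg hs.1 hh.le
    have hzh : IntervalIntegrable (fun s => z (s + h)) volume 0 t :=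
      (hzc.comp (continuous_add_const h)).intervalIntegrable _ _
    have hKh : IntervalIntegrable (fun s => h • K h s) volume 0 t := hKi.smul h
    rw [this, intervalIntegral.integral_sub hzh hKh,
      intervalIntegral.integral_smul, intervalIntegral.integral_comp_add_right, zero_add]
  have e2 : ∀ r : ℝ, h • ∫ θ in (0 : ℝ)..1, z (h * θ + r) = ∫ s in r..h + r, z s := by
    intro r
    rw [intervalIntegral.smul_integral_comp_mul_add]
    simp
  have e3 : (∫ s in h..t + h, z s) - ∫ s in (0 : ℝ)..t, z s =
      (∫ s in t..t + h, z s) - ∫ s in (0 : ℝ)..h, z s := by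
    have i1 := intervalIntegral.integral_add_adjacent_intervals (hi 0 h) (hi h (t + h))
    have i2 := intervalIntegral.integral_add_adjacent_intervals (hi 0 t) (hi t (t + h))
    rw [sub_eq_sub_iff_add_eq_add, add_comm (∫ s in h..t + h, z s), i1, ← i2, add_comm]
  have e4 := e2 t
  have e5 := e2 0
  rw [add_comm h t] at e4
  rw [add_zero] at e5
  apply smul_right_injective X hh.ne'
  simp only [smul_sub, smul_add, smul_smul, mul_inv_cancel₀ hh.ne', one_smul, map_add]
  rw [e4, e5, e1, sub_eq_iff_eq_add.mp e3]
  abel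

end Semigroup

/-! ### Supremum norms on intervals -/

section Norms

variable {X : Type*} [NormedAddCommGroup X] {a b : ℝ} {f g : ℝ → X}

theorem norm_sq_le_supNormSq (hf : ContinuousOn f (Set.Icc a b)) {t : ℝ}
    (ht : t ∈ Set.Icc a b) : ‖f t‖ ^ 2 ≤ supNormSq a b f := by
  have hb := (isCompact_Icc.image_of_continuousOn (hf.norm.pow 2)).bddAbove
  refine le_ciSup (f := fun t : Set.Icc a b => ‖f t‖ ^ 2) (hb.mono ?_) ⟨t, ht⟩
  rintro _ ⟨s, rfl⟩
  exact ⟨s, s.2, rfl⟩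

theorem supNormSq_le (hab : a ≤ b) {B : ℝ} (h : ∀ t ∈ Set.Icc a b, ‖f t‖ ^ 2 ≤ B) :
    supNormSq a b f ≤ B :=
  have : Nonempty (Set.Icc a b) := ⟨⟨a, le_rfl, hab⟩⟩
  ciSup_le fun t => h t t.2

theorem supNormSq_nonneg : 0 ≤ supNormSq a b f :=
  Real.iSup_nonneg fun _ => sq_nonneg _

theorem supNormSq_congr (h : Set.EqOn f g (Set.Icc a b)) : supNormSq a b f = supNormSq a b g :=
  iSup_congr fun t => by rw [h t.2]

variable [NormedSpace ℝ X]

theorem c1NormSq_nonneg : 0 ≤ c1NormSq a b f :=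
  add_nonneg supNormSq_nonneg supNormSq_nonneg

theorem c1NormSq_congr (h : Set.EqOn f g (Set.Icc a b)) : c1NormSq a b f = c1NormSq a b g := by
  rw [c1NormSq, c1NormSq, supNormSq_congr h,
    supNormSq_congr fun t ht => derivWithin_congr h (h ht)]

theorem c1NormSq_zero : c1NormSq a b (fun _ => (0 : X)) = 0 := by
  simp [c1NormSq, supNormSq]

theorem supNormSq_le_c1NormSq : supNormSq a b f ≤ c1NormSq a b f :=
  le_add_of_nonneg_right supNormSq_nonneg

theorem norm_le_sqrt_c1NormSq (hf : ContinuousOn f (Set.Icc a b)) {t : ℝ}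
    (ht : t ∈ Set.Icc a b) : ‖f t‖ ≤ √(c1NormSq a b f) :=
  Real.le_sqrt_of_sq_le ((norm_sq_le_supNormSq hf ht).trans supNormSq_le_c1NormSq)

theorem norm_derivWithin_le_sqrt_c1NormSq (hab : a < b) (hf : ContDiffOn ℝ 1 f (Set.Icc a b))
    {t : ℝ} (ht : t ∈ Set.Icc a b) : ‖derivWithin f (Set.Icc a b) t‖ ≤ √(c1NormSq a b f) :=
  Real.le_sqrt_of_sq_le ((norm_sq_le_supNormSq
    (hf.continuousOn_derivWithin (uniqueDiffOn_Icc hab) le_rfl) ht).trans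
    (le_add_of_nonneg_left supNormSq_nonneg))

theorem derivWithin_Icc_subinterval {δ : ℝ} (haδ : a ≤ δ) (hδ : δ < b)
    (hf : DifferentiableOn ℝ f (Set.Icc a b)) {t : ℝ} (ht : t ∈ Set.Icc δ b) :
    derivWithin f (Set.Icc δ b) t = derivWithin f (Set.Icc a b) t :=
  derivWithin_subset (Set.Icc_subset_Icc_left haδ) (uniqueDiffOn_Icc hδ t ht)
    (hf t (Set.Icc_subset_Icc_left haδ ht))

theorem c1NormSq_subinterval_le {δ : ℝ} (haδ : a ≤ δ) (hδ : δ < b)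
    (hf : ContDiffOn ℝ 1 f (Set.Icc a b)) : c1NormSq δ b f ≤ c1NormSq a b f := by
  have hsub := Set.Icc_subset_Icc_left (b := b) haδ
  refine add_le_add (supNormSq_le hδ.le fun t ht => norm_sq_le_supNormSq hf.continuousOn (hsub ht))
    (supNormSq_le hδ.le fun t ht => ?_)
  rw [derivWithin_Icc_subinterval haδ hδ (hf.differentiableOn one_ne_zero) ht]
  exact norm_sq_le_supNormSq
    (hf.continuousOn_derivWithin (uniqueDiffOn_Icc (haδ.trans_lt hδ)) le_rfl) (hsub ht)

end Norms

/-! ### The Cauchy problem for one coefficient -/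

section Cauchy

variable {X : Type*} [NormedAddCommGroup X] [NormedSpace ℝ X] {S : ℝ → X →L[ℝ] X}

/-- For `f` of class `C¹` and `x` in the domain of the generator, `v' = 𝓛 v + f`, `v(0) = x` has a
solution of class `C¹` on the closed interval, and its norm is controlled by the data: `v` is the
primitive of the mild solution of the differentiated equation. -/
theorem exists_c1_solution [CompleteSpace X] (hS : IsC0Semigroup S)
    (hJ : Continuous fun p : ℝ × X => S |p.1| p.2) {T C : ℝ} (hT : 0 < T)
    (hC : ∀ t, 0 ≤ t → t ≤ T → ‖S t‖ ≤ C) {x y : X}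
    (hxy : Tendsto (fun h : ℝ => h⁻¹ • (S h x - x)) (𝓝[>] 0) (𝓝 y)) {f : ℝ → X}
    (hf : ContDiffOn ℝ 1 f (Set.Icc 0 T)) :
    ∃ v : ℝ → X, ContDiffOn ℝ 1 v (Set.Icc 0 T) ∧ v 0 = x ∧
      (∀ t ∈ Set.Icc 0 T, Tendsto (fun h : ℝ => h⁻¹ • (S h (v t) - v t)) (𝓝[>] 0)
        (𝓝 (derivWithin v (Set.Icc 0 T) t - f t))) ∧
      c1NormSq 0 T v ≤ ((1 + T * (C * (2 + T))) ^ 2 + (C * (2 + T)) ^ 2) *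
        (‖x‖ ^ 2 + ‖y‖ ^ 2 + c1NormSq 0 T f) := by
  have hC0 : 0 ≤ C := (norm_nonneg _).trans (hC 0 le_rfl hT.le)
  have hf' : ContinuousOn (derivWithin f (Set.Icc 0 T)) (Set.Icc 0 T) :=
    hf.continuousOn_derivWithin (uniqueDiffOn_Icc hT) le_rfl
  -- A continuous extension of `f'` to the whole line makes all shifts in time admissible.
  set g : ℝ → X := Set.IccExtend hT.le ((Set.Icc 0 T).domRestrict (derivWithin f (Set.Icc 0 T)))
    with hg
  have hgc : Continuous g := (continuousOn_iff_continuous_domRestrict.mp hf').Icc_extend'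
  have hgf : ∀ t ∈ Set.Icc 0 T, g t = derivWithin f (Set.Icc 0 T) t := fun t ht =>
    Set.IccExtend_of_mem hT.le _ ht
  have hprim : ∀ t ∈ Set.Icc 0 T, f 0 + ∫ s in (0 : ℝ)..t, g s = f t := by
    intro t ht
    rw [intervalIntegral.integral_eq_sub_of_hasDerivAt_of_le ht.1
      (hf.continuousOn.mono (Set.Icc_subset_Icc_right ht.2)) (fun s hs => ?_)
      (hgc.intervalIntegrable _ _), add_sub_cancel]
    have hs' : s ∈ Set.Ioo 0 T := ⟨hs.1, hs.2.trans_le ht.2⟩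
    rw [hgf s (Set.Ioo_subset_Icc_self hs')]
    exact ((hf.differentiableOn one_ne_zero s
      (Set.Ioo_subset_Icc_self hs')).hasDerivWithinAt).hasDerivAt (Icc_mem_nhds hs'.1 hs'.2)
  set z := mildSolution S (y + f 0) g with hz
  have hzc : Continuous z := continuous_mildSolution hJ _ hgc
  set v : ℝ → X := fun t => x + ∫ s in (0 : ℝ)..t, z s with hv
  have hvd : ∀ t, HasDerivAt v (z t) t := fun t =>
    (hzc.integral_hasStrictDerivAt 0 t).hasDerivAt.const_add x
  have hvw : ∀ t ∈ Set.Icc 0 T, derivWithin v (Set.Icc 0 T) t = z t := fun t ht =>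
    (hvd t).hasDerivWithinAt.derivWithin (uniqueDiffOn_Icc hT t ht)
  set A := ‖x‖ ^ 2 + ‖y‖ ^ 2 + c1NormSq 0 T f with hA
  have hNf : (0 : ℝ) ≤ c1NormSq 0 T f := c1NormSq_nonneg
  have hxA : ‖x‖ ≤ √A := Real.le_sqrt_of_sq_le (by rw [hA]; nlinarith [sq_nonneg ‖y‖])
  have hyA : ‖y‖ ≤ √A := Real.le_sqrt_of_sq_le (by rw [hA]; nlinarith [sq_nonneg ‖x‖])
  have hNA : √(c1NormSq 0 T f) ≤ √A :=
    Real.sqrt_le_sqrt (by rw [hA]; nlinarith [sq_nonneg ‖x‖, sq_nonneg ‖y‖])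
  have hA0 : 0 ≤ A := by rw [hA]; positivity
  have hzb : ∀ t ∈ Set.Icc 0 T, ‖z t‖ ≤ C * (2 + T) * √A := by
    intro t ht
    have h1 := norm_mildSolution_le hC (y + f 0) (g := g) (N := √A) (fun s hs => by
      rw [hgf s hs]; exact (norm_derivWithin_le_sqrt_c1NormSq hT hf hs).trans hNA) ht
    have h2 : ‖y + f 0‖ ≤ √A + √A := (norm_add_le _ _).trans (add_le_add hyA
      ((norm_le_sqrt_c1NormSq hf.continuousOn ⟨le_rfl, hT.le⟩).trans hNA))
    calc ‖z t‖ ≤ _ := h1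
      _ ≤ C * (√A + √A) + C * √A * T := by gcongr
      _ = C * (2 + T) * √A := by ring
  have hvb : ∀ t ∈ Set.Icc 0 T, ‖v t‖ ≤ (1 + T * (C * (2 + T))) * √A := by
    intro t ht
    have h1 : ‖∫ s in (0 : ℝ)..t, z s‖ ≤ C * (2 + T) * √A * |t - 0| :=
      intervalIntegral.norm_integral_le_of_norm_le_const fun s hs => by
        rw [Set.uIoc_of_le ht.1] at hs
        exact hzb s ⟨hs.1.le, hs.2.trans ht.2⟩
    rw [sub_zero, abs_of_nonneg ht.1] at h1
    calc ‖v t‖ ≤ ‖x‖ + ‖∫ s in (0 : ℝ)..t, z s‖ := norm_add_le _ _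
      _ ≤ √A + C * (2 + T) * √A * T :=
        add_le_add hxA (h1.trans (mul_le_mul_of_nonneg_left ht.2 (by positivity)))
      _ = (1 + T * (C * (2 + T))) * √A := by ring
  have hsq : ∀ {r B : ℝ}, 0 ≤ r → r ≤ B * √A → r ^ 2 ≤ B ^ 2 * A := by
    intro r B hr hrB
    calc r ^ 2 ≤ (B * √A) ^ 2 := pow_le_pow_left₀ hr hrB 2
      _ = B ^ 2 * A := by rw [mul_pow, Real.sq_sqrt hA0]
  refine ⟨v, ?_, by simp [hv], fun t ht => ?_, ?_⟩
  · refine ContDiff.contDiffOn (contDiff_one_iff_deriv.mpr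
      ⟨fun t => (hvd t).differentiableAt, ?_⟩)
    rwa [show deriv v = z from funext fun t => (hvd t).deriv]
  · rw [hvw t ht, ← hprim t ht]
    exact tendsto_integral_mildSolution hS hJ hxy (f 0) hgc ht.1
  · rw [add_mul]
    refine add_le_add (supNormSq_le hT.le fun t ht => hsq (norm_nonneg _) (hvb t ht))
      (supNormSq_le hT.le fun t ht => hsq (norm_nonneg _) ?_)
    rw [hvw t ht]
    exact hzb t ht

/-- Two solutions of `v' = 𝓛 v + f` on `(0, T)`, both continuous up to the initial time, agree if
they have the same initial value. -/
theorem IsC0Semigroup.eqOn_of_solutions (hS : IsC0Semigroup S)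
    (hB : ∀ b : ℝ, ∃ C : ℝ, ∀ t, 0 ≤ t → t ≤ b → ‖S t‖ ≤ C) {T : ℝ} {u v f : ℝ → X}
    (huc : ContinuousOn u (Set.Icc 0 T)) (hvc : ContinuousOn v (Set.Icc 0 T)) (h0 : u 0 = v 0)
    (hud : ∀ s ∈ Set.Ioo 0 T, DifferentiableWithinAt ℝ u (Set.Icc 0 T) s)
    (hvd : ∀ s ∈ Set.Ioo 0 T, DifferentiableWithinAt ℝ v (Set.Icc 0 T) s)
    (hu : ∀ s ∈ Set.Ioo 0 T, Tendsto (fun h : ℝ => h⁻¹ • (S h (u s) - u s)) (𝓝[>] 0)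
      (𝓝 (derivWithin u (Set.Icc 0 T) s - f s)))
    (hv : ∀ s ∈ Set.Ioo 0 T, Tendsto (fun h : ℝ => h⁻¹ • (S h (v s) - v s)) (𝓝[>] 0)
      (𝓝 (derivWithin v (Set.Icc 0 T) s - f s))) :
    Set.EqOn u v (Set.Icc 0 T) := by
  intro t ht
  refine sub_eq_zero.mp (hS.eq_zero_of_hasDerivWithinAt hB (w := fun s => u s - v s)
    (w' := fun s => derivWithin u (Set.Icc 0 T) s - derivWithin v (Set.Icc 0 T) s)
    (huc.sub hvc) (sub_eq_zero.mpr h0)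
    (fun s hs => (hud s hs).hasDerivWithinAt.sub (hvd s hs).hasDerivWithinAt)
    (fun s hs => ?_) t ht)
  have h := (hu s hs).sub (hv s hs)
  rw [sub_sub_sub_cancel_right] at h
  refine h.congr fun r => ?_
  rw [← smul_sub, map_sub]
  congr 1
  abel

end Cauchy

/-! ### Processes with prescribed coefficients -/

section Processes

variable {Ω : Type*} [MeasurableSpace Ω] {P : Measure Ω} [IsProbabilityMeasure P]
  {ξ : ℕ → Ω → ℝ} {X : Type*} [NormedAddCommGroup X] [NormedSpace ℝ X] [CompleteSpace X]
  {a b T : ℝ} {U : ℝ → Ω → X} {v : MultiIndex → ℝ → X}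

theorem eqOn_coeff (hξ : IsUniformSequence P ξ)
    (hU : ∀ t ∈ Set.Icc a b, HasChaosExpansion P ξ (U t) fun α => v α t) (α : MultiIndex) :
    Set.EqOn (fun t => coeff P ξ (U t) α) (v α) (Set.Icc a b) :=
  fun t ht => (hU t ht).coeff_eq hξ α

theorem hasChaosExpansion_coeff (hξ : IsUniformSequence P ξ)
    (hU : ∀ t ∈ Set.Icc a b, HasChaosExpansion P ξ (U t) fun α => v α t) :
    ∀ t ∈ Set.Icc a b, HasChaosExpansion P ξ (U t) (coeff P ξ (U t)) := fun t ht => by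
  rw [(hU t ht).coeff_eq' hξ]
  exact hU t ht

theorem memTensorC1_of_expansion (hξ : IsUniformSequence P ξ)
    (hU : ∀ t ∈ Set.Icc a b, HasChaosExpansion P ξ (U t) fun α => v α t)
    (hv : ∀ α, ContDiffOn ℝ 1 (v α) (Set.Icc a b))
    (hsum : Summable fun α => c1NormSq a b (v α) * expSq P ξ α) : MemTensorC1 P ξ a b U where
  expansion := hasChaosExpansion_coeff hξ hU
  contDiffOn α := (hv α).congr (eqOn_coeff hξ hU α)
  summable := hsum.congr fun α => by rw [c1NormSq_congr (eqOn_coeff hξ hU α)]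

theorem memTensorC_of_expansion (hξ : IsUniformSequence P ξ)
    (hU : ∀ t ∈ Set.Icc a b, HasChaosExpansion P ξ (U t) fun α => v α t)
    (hv : ∀ α, ContinuousOn (v α) (Set.Icc a b))
    (hsum : Summable fun α => supNormSq a b (v α) * expSq P ξ α) : MemTensorC P ξ a b U where
  expansion := hasChaosExpansion_coeff hξ hU
  continuousOn α := (hv α).congr (eqOn_coeff hξ hU α)
  summable := hsum.congr fun α => by rw [supNormSq_congr (eqOn_coeff hξ hU α)]

theorem tensorC1NormSq_of_expansion (hξ : IsUniformSequence P ξ)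
    (hU : ∀ t ∈ Set.Icc a b, HasChaosExpansion P ξ (U t) fun α => v α t) :
    tensorC1NormSq P ξ a b U = ∑' α, c1NormSq a b (v α) * expSq P ξ α :=
  tsum_congr fun α => by rw [c1NormSq_congr (eqOn_coeff hξ hU α)]

open Classical in
theorem hasChaosExpansion_truncated (hξ : IsUniformSequence P ξ) (m K : ℕ)
    (hU : ∀ t ∈ Set.Icc a b, HasChaosExpansion P ξ (U t) fun α => v α t) :
    ∀ t ∈ Set.Icc a b, HasChaosExpansion P ξ (truncated P ξ m K U t) fun α =>
      (if α ∈ truncIndex m K then v α else fun _ => 0) t := by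
  intro t ht
  have h := hasChaosExpansion_finset_sum hξ (truncIndex_finite m K).toFinset fun α => v α t
  have hcoeff : truncated P ξ m K U t =
      fun ω => ∑ α ∈ (truncIndex_finite m K).toFinset, fourierLegendre ξ α ω • v α t := by
    funext ω
    rw [truncated, (hU t ht).coeff_eq' hξ]
  rw [hcoeff]
  convert h using 2 with α
  simp only [Set.Finite.mem_toFinset]
  split_ifs <;> rfl

open Classical in
theorem hasChaosExpansion_sub_truncated (hξ : IsUniformSequence P ξ) (m K : ℕ)
    (hU : ∀ t ∈ Set.Icc a b, HasChaosExpansion P ξ (U t) fun α => v α t) :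
    ∀ t ∈ Set.Icc a b, HasChaosExpansion P ξ ((U - truncated P ξ m K U) t) fun α =>
      (if α ∈ truncIndex m K then fun _ => 0 else v α) t := by
  intro t ht
  have h : HasChaosExpansion P ξ ((U - truncated P ξ m K U) t) _ :=
    (hU t ht).sub hξ (hasChaosExpansion_truncated hξ m K hU t ht)
  convert h using 2 with α
  split_ifs <;> simp

/-- Comparing coefficients decouples the equation: each coefficient of a classical solution
solves a deterministic Cauchy problem. -/
theorem IsClassicalSolution.coeff_equation (hξ : IsUniformSequence P ξ) {𝓛 : X →ₗ.[ℝ] X}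
    {G : ℝ → Ω → X} {u₀ : Ω → X} (hG : MemTensorC1 P ξ 0 T G)
    (hU : IsClassicalSolution P ξ T 𝓛 G u₀ U) {t : ℝ} (ht : 0 < t) (htT : t ≤ T)
    (α : MultiIndex) :
    DifferentiableWithinAt ℝ (fun s => coeff P ξ (U s) α) (Set.Icc 0 T) t ∧
      (coeff P ξ (U t) α, derivWithin (fun s => coeff P ξ (U s) α) (Set.Icc 0 T) t -
        coeff P ξ (G t) α) ∈ 𝓛.graph := by
  obtain ⟨V, W, ⟨hd, hV⟩, ⟨hdom, hW⟩, heq⟩ := hU.equation t ht htT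
  refine ⟨hd α, ?_⟩
  have hVG := hV.sub hξ (hG.expansion t ⟨ht.le, htT⟩)
  have hW' : HasChaosExpansion P ξ W _ := hVG.congr_ae (by
    filter_upwards [heq] with ω hω
    rw [hω, add_sub_cancel_right])
  rw [← hW'.coeff_eq hξ α, hW.coeff_eq hξ α]
  exact 𝓛.mem_graph ⟨_, hdom α⟩

end Processes

end WienerLegendre

theorem theorem3p2 (M w T : ℝ) (hM : 0 < M) (hT : 0 < T) :
    ∃ c : ℝ, 0 < c ∧
      ∀ (X : Type*) [NormedAddCommGroup X] [NormedSpace ℝ X] [CompleteSpace X]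
        (Ω : Type*) [MeasurableSpace Ω] (P : Measure Ω) [IsProbabilityMeasure P]
        (ξ : ℕ → Ω → ℝ) (_ : IsUniformSequence P ξ)
        -- the semigroup of type `(M, w)` and its densely defined generator
        (𝓛 : X →ₗ.[ℝ] X) (S : ℝ → X →L[ℝ] X)
        (_ : Dense (𝓛.domain : Set X)) (_ : IsC0Semigroup S) (_ : IsGenerator S 𝓛)
        (_ : ∀ t, 0 ≤ t → ‖S t‖ ≤ M * Real.exp (w * t))
        -- the initial value, with `u⁰` and `𝓛 u⁰` in `X ⊗ (L)²`
        (u₀ : Ω → X) (_ : MemTensor P ξ u₀) (hdom : ∀ α, coeff P ξ u₀ α ∈ 𝓛.domain)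
        (_ : Summable fun α => ‖𝓛 ⟨coeff P ξ u₀ α, hdom α⟩‖ ^ 2 * expSq P ξ α)
        -- the noise, in `C¹([0,T], X) ⊗ (L)²`
        (G : ℝ → Ω → X) (_ : MemTensorC1 P ξ 0 T G),
        -- in a Hilbert space the solution exists
        (InnerProductSpaceable X → ∃ u : ℝ → Ω → X, IsClassicalSolution P ξ T 𝓛 G u₀ u) ∧
        ∀ u : ℝ → Ω → X, IsClassicalSolution P ξ T 𝓛 G u₀ u →
          MemTensorC1 P ξ 0 T u ∧
          ∀ m K : ℕ,
            MemTensorC1 P ξ 0 T (truncated P ξ m K u) ∧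
            MemTensorC1 P ξ 0 T (u - truncated P ξ m K u) ∧
            (Summable fun α : {α : MultiIndex // α ∉ truncIndex m K} =>
              (‖coeff P ξ u₀ α‖ ^ 2 + ‖𝓛 ⟨coeff P ξ u₀ α, hdom α⟩‖ ^ 2
                + c1NormSq 0 T (fun t => coeff P ξ (G t) α)) * expSq P ξ α) ∧
            tensorC1NormSq P ξ 0 T (u - truncated P ξ m K u) ≤
              c * ∑' α : {α : MultiIndex // α ∉ truncIndex m K},
                (‖coeff P ξ u₀ α‖ ^ 2 + ‖𝓛 ⟨coeff P ξ u₀ α, hdom α⟩‖ ^ 2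
                  + c1NormSq 0 T (fun t => coeff P ξ (G t) α)) * expSq P ξ α := by
  classical
  set C : ℝ := M * Real.exp (|w| * T) with hCdef
  have hC0 : 0 < C := by positivity
  set c : ℝ := (1 + T * (C * (2 + T))) ^ 2 + (C * (2 + T)) ^ 2 with hc
  have hc0 : 0 < c := by positivity
  refine ⟨c, hc0, ?_⟩
  intro X _ _ _ Ω _ P _ ξ hξ 𝓛 S _ hS hgen hSb u₀ hu₀ hdom hLu₀ G hG
  have hB : ∀ b t : ℝ, 0 ≤ t → t ≤ b → ‖S t‖ ≤ M * Real.exp (|w| * b) := fun b t h0 hb =>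
    (hSb t h0).trans (mul_le_mul_of_nonneg_left (Real.exp_le_exp.mpr
      ((mul_le_mul_of_nonneg_right (le_abs_self w) h0).trans
        (mul_le_mul_of_nonneg_left hb (abs_nonneg w)))) hM.le)
  have hB' : ∀ b : ℝ, ∃ C : ℝ, ∀ t, 0 ≤ t → t ≤ b → ‖S t‖ ≤ C := fun b => ⟨_, hB b⟩
  have hJ := hS.continuous_abs hB'
  -- The coefficients of the solution, one deterministic problem for each multi-index.
  have hsol := fun α => exists_c1_solution hS hJ hT (hB T)
    ((hgen _ _).mp (𝓛.mem_graph ⟨coeff P ξ u₀ α, hdom α⟩)) (hG.contDiffOn α)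
  choose v hvC1 hv0 hveq hvbound using hsol
  set A : MultiIndex → ℝ := fun α => ‖coeff P ξ u₀ α‖ ^ 2 +
    ‖𝓛 ⟨coeff P ξ u₀ α, hdom α⟩‖ ^ 2 + c1NormSq 0 T (fun t => coeff P ξ (G t) α) with hA
  have hA0 : ∀ α, 0 ≤ A α := fun α => by
    have := c1NormSq_nonneg (a := 0) (b := T) (f := fun t => coeff P ξ (G t) α)
    positivity
  have he : ∀ α, 0 ≤ expSq P ξ α := fun α => (expSq_pos hξ α).le
  have hAsum : Summable fun α => A α * expSq P ξ α :=
    ((hu₀.2.add hLu₀).add hG.summable).congr fun α => by simp only [hA, add_mul]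
  have hle : ∀ α, c1NormSq 0 T (v α) * expSq P ξ α ≤ c * (A α * expSq P ξ α) := fun α => by
    rw [← mul_assoc]
    exact mul_le_mul_of_nonneg_right (hvbound α) (he α)
  have hvsum : Summable fun α => c1NormSq 0 T (v α) * expSq P ξ α :=
    (hAsum.mul_left c).of_nonneg_of_le (fun α => mul_nonneg c1NormSq_nonneg (he α)) hle
  refine ⟨fun hX => ?_, fun u hu => ?_⟩
  · have hcomp : ∀ {k : MultiIndex → X}, (∀ α, ‖k α‖ ≤ √(c1NormSq 0 T (v α))) →
        Summable fun α => ‖k α‖ ^ 2 * expSq P ξ α := fun {k} hk =>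
      hvsum.of_nonneg_of_le (fun α => mul_nonneg (sq_nonneg _) (he α)) fun α =>
        mul_le_mul_of_nonneg_right
          ((Real.le_sqrt (norm_nonneg _) c1NormSq_nonneg).mp (hk α)) (he α)
    have hexU : ∀ t, ∃ F : Ω → X, t ∈ Set.Icc 0 T → HasChaosExpansion P ξ F fun α => v α t := by
      intro t
      by_cases ht : t ∈ Set.Icc 0 T
      · obtain ⟨F, hF⟩ := exists_hasChaosExpansion hξ (f := fun α => v α t)
          (hcomp fun α => norm_le_sqrt_c1NormSq (hvC1 α).continuousOn ht)
        exact ⟨F, fun _ => hF⟩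
      · exact ⟨0, fun h => absurd h ht⟩
    choose U hU using hexU
    refine ⟨U, ?_, fun δ hδ0 hδT => ?_, fun t ht0 htT => ?_, ?_⟩
    · exact memTensorC_of_expansion hξ hU (fun α => (hvC1 α).continuousOn)
        (hvsum.of_nonneg_of_le (fun α => mul_nonneg supNormSq_nonneg (he α)) fun α =>
          mul_le_mul_of_nonneg_right supNormSq_le_c1NormSq (he α))
    · have hsub : Set.Icc δ T ⊆ Set.Icc 0 T := Set.Icc_subset_Icc_left hδ0.le
      exact memTensorC1_of_expansion hξ (fun t ht => hU t (hsub ht))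
        (fun α => (hvC1 α).mono hsub)
        (hvsum.of_nonneg_of_le (fun α => mul_nonneg c1NormSq_nonneg (he α)) fun α =>
          mul_le_mul_of_nonneg_right (c1NormSq_subinterval_le hδ0.le hδT (hvC1 α)) (he α))
    · have ht : t ∈ Set.Icc 0 T := ⟨ht0.le, htT⟩
      have heq := eqOn_coeff hξ hU
      obtain ⟨V, hV⟩ := exists_hasChaosExpansion hξ
        (f := fun α => derivWithin (v α) (Set.Icc 0 T) t)
        (hcomp fun α => norm_derivWithin_le_sqrt_c1NormSq hT (hvC1 α) ht)
      have hgraph : ∀ α, ∃ h : coeff P ξ (U t) α ∈ 𝓛.domain, 𝓛 ⟨coeff P ξ (U t) α, h⟩ =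
          derivWithin (v α) (Set.Icc 0 T) t - coeff P ξ (G t) α := by
        intro α
        obtain ⟨p, hp1, hp2⟩ := 𝓛.mem_graph_iff.mp ((hgen _ _).mpr (hveq α t ht))
        have hp : (p : X) = coeff P ξ (U t) α := hp1.trans (heq α ht).symm
        exact ⟨hp ▸ p.2, (congrArg 𝓛 (Subtype.ext hp.symm)).trans hp2⟩
      choose hdomU hLU using hgraph
      -- With `V - G` as the image under `𝓛` the equation is an identity, and the coefficients of
      -- `V - G` are the right ones by the deterministic equations.
      refine ⟨V, fun ω => V ω - G t ω, ⟨fun α => ?_, ?_⟩, ⟨hdomU, ?_⟩, ?_⟩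
      · exact ((hvC1 α).differentiableOn one_ne_zero t ht).congr (heq α) (heq α ht)
      · simpa only [derivWithin_congr (heq _) (heq _ ht)] using hV
      · simpa only [hLU] using hV.sub hξ (hG.expansion t ht)
      · exact .of_forall fun ω => (sub_add_cancel _ _).symm
    · have h0 := hU 0 ⟨le_rfl, hT.le⟩
      simp only [hv0] at h0
      exact h0.ae_eq hξ hu₀.1
  · have heq : ∀ α, Set.EqOn (fun t => coeff P ξ (u t) α) (v α) (Set.Icc 0 T) := by
      intro α
      refine hS.eqOn_of_solutions hB' (f := fun t => coeff P ξ (G t) α) (hu.memC.continuousOn α)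
        (hvC1 α).continuousOn ?_
        (fun s hs => (hu.coeff_equation hξ hG hs.1 hs.2.le α).1)
        (fun s hs => (hvC1 α).differentiableOn one_ne_zero s (Set.Ioo_subset_Icc_self hs))
        (fun s hs => (hgen _ _).mp (hu.coeff_equation hξ hG hs.1 hs.2.le α).2)
        (fun s hs => hveq α s (Set.Ioo_subset_Icc_self hs))
      rw [hv0]
      exact (hu₀.1.congr_ae hu.initial.symm).coeff_eq hξ α
    have hU : ∀ t ∈ Set.Icc 0 T, HasChaosExpansion P ξ (u t) fun α => v α t := by
      intro t ht
      rw [← funext fun α => heq α ht]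
      exact hu.memC.expansion t ht
    refine ⟨memTensorC1_of_expansion hξ hU hvC1 hvsum, fun m K => ?_⟩
    have hsubsum : ∀ {k : MultiIndex → ℝ → X}, (∀ α, k α = v α ∨ k α = fun _ => 0) →
        (∀ α, ContDiffOn ℝ 1 (k α) (Set.Icc 0 T)) ∧
          Summable fun α => c1NormSq 0 T (k α) * expSq P ξ α := by
      intro k hk
      refine ⟨fun α => ?_, hvsum.of_nonneg_of_le
        (fun α => mul_nonneg c1NormSq_nonneg (he α)) fun α => ?_⟩
      · rcases hk α with h | h <;> rw [h]
        · exact hvC1 α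
        · exact contDiffOn_const
      · refine mul_le_mul_of_nonneg_right ?_ (he α)
        rcases hk α with h | h <;> rw [h]
        rw [c1NormSq_zero]
        exact c1NormSq_nonneg
    have htrunc := hasChaosExpansion_truncated hξ m K hU
    have hrest := hasChaosExpansion_sub_truncated hξ m K hU
    obtain ⟨hk1, hs1⟩ := hsubsum
      (k := fun α => if α ∈ truncIndex m K then v α else fun _ => 0)
      fun α => by split_ifs <;> simp
    obtain ⟨hk2, hs2⟩ := hsubsum
      (k := fun α => if α ∈ truncIndex m K then fun _ => 0 else v α)
      fun α => by split_ifs <;> simp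
    refine ⟨memTensorC1_of_expansion hξ htrunc hk1 hs1,
      memTensorC1_of_expansion hξ hrest hk2 hs2, hAsum.subtype (truncIndex m K)ᶜ, ?_⟩
    have htsum : ∑' α : {α : MultiIndex // α ∉ truncIndex m K}, A α * expSq P ξ α =
        ∑' α, (truncIndex m K)ᶜ.indicator (fun α => A α * expSq P ξ α) α :=
      tsum_subtype (truncIndex m K)ᶜ fun α => A α * expSq P ξ α
    rw [htsum, tensorC1NormSq_of_expansion hξ hrest, ← tsum_mul_left]
    refine hs2.tsum_le_tsum (fun α => ?_) ((hAsum.indicator _).mul_left c)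
    by_cases hα : α ∈ truncIndex m K
    · simp [hα, c1NormSq_zero]
    · simpa [hα] using hle α
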